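/- Let $K$ be a field with $\operatorname{char} K \neq 2$, let $\alpha \in K\setminus\{0\}$, let $E$ be a finite-dimensional $K$-vector space and let $u$ be an endomorphism of $E$. Call $u$ an $(\alpha,-\alpha)$-composite if $u = \alpha p - \alpha q$ for some idempotent endomorphisms $p, q$ of $E$ ($p^2=p$, $q^2=q$). For $\lambda \in K$ and $k \geq 1$ put $$n_k(u,\lambda) = \dim \operatorname{Ker}(u-\lambda\,\mathrm{id})^k - \dim \operatorname{Ker}(u-\lambda\,\mathrm{id})^{k-1}.$$ Two sequences $(a_k)_{k\ge 1}$, $(b_k)_{k\ge 1}$ of non-negative integers are called intertwined if $b_{k+1} \leq a_k$ and $a_{k+1} \leq b_k$ for all $k \geq 1$. Write the minimal polynomial of $u$ as $\mu_u = PQ$ with $P, Q$ monic, $P$ a product of linear factors $X-\lambda$ with $\lambda\in\{0,\alpha,-\alpha\}$, and $Q$ without root in $\{0,\alpha,-\alpha\}$; let $u_{-\{0,\alpha,-\alpha\}}$ be the endomorphism of $\operatorname{Ker} Q(u)$ induced by $u$. The elementary factors (invariant factors) of an endomorphism $v$ are the monic nonconstant polynomials $P_1 \mid P_2 \mid \dots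 \mid P_N$ such that $v$ is similar to the block-diagonal matrix whose blocks are the companion matrices of $P_1,\dots,P_N$. Then $u$ is an $(\alpha,-\alpha)$-composite if and only if both of the following conditions hold: (i) the sequences $(n_k(u,\alpha))_{k \geq 1}$ and $(n_k(u,-\alpha))_{k\geq 1}$ are intertwined; (ii) the elementary factors of $u_{-\{0,\alpha,-\alpha\}}$ are all even polynomials, i.e. polynomials in $X^2$. -/

import Mathlib

namespace Composite

open Polynomial

/-- An element `x` of a `K`-algebra is an `(α, β)`-composite when `x = α p + β q` for some
idempotents `p` and `q`. -/
def IsComposite {K A : Type*} [Field K] [Ring A] [Algebra K A] (α β : K) (x : A) : Prop :=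
  ∃ p q : A, IsIdempotentElem p ∧ IsIdempotentElem q ∧ x = α • p + β • q

/-- `jordanNum u t k = dim Ker (u - t)^k - dim Ker (u - t)^(k-1)` for `k ≥ 1`: the number of Jordan
blocks of size at least `k` for `t`. The kernels increase with `k`, so that the subtraction of
natural numbers is the usual one. Only the values at `k ≥ 1` are used. -/
noncomputable def jordanNum {K E : Type*} [Field K] [AddCommGroup E] [Module K E]
    (u : Module.End K E) (t : K) (k : ℕ) : ℕ :=
  Module.finrank K (LinearMap.ker ((u - algebraMap K (Module.End K E) t) ^ k)) -
    Module.finrank K (LinearMap.ker ((u - algebraMap K (Module.End K E) t) ^ (k - 1)))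

/-- Two sequences `(a_k)` and `(b_k)`, indexed by `k ≥ 1`, are intertwined when
`b_(k+1) ≤ a_k` and `a_(k+1) ≤ b_k` for all `k ≥ 1`. -/
def Intertwined (a b : ℕ → ℕ) : Prop :=
  ∀ k : ℕ, 1 ≤ k → b (k + 1) ≤ a k ∧ a (k + 1) ≤ b k

open Classical in
/-- The product of the factors `X - t` of `p` with `t ∈ S`, counted with multiplicity: the monic
factor of `p` that splits with all its roots in `S`, the cofactor having no root in `S`. -/
noncomputable def partOn {K : Type*} [Field K] (S : Set K) (p : K[X]) : K[X] :=
  ((p.roots.filter (fun t => t ∈ S)).map (fun t => X - C t)).prod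

/-- The cofactor of `partOn S p` in `p`; it has no root in `S` when `p ≠ 0`. -/
noncomputable def partOff {K : Type*} [Field K] (S : Set K) (p : K[X]) : K[X] :=
  p /ₘ partOn S p

/-- The two parts multiply to `p`. -/
theorem partOn_mul_partOff {K : Type*} [Field K] (S : Set K) (p : K[X]) :
    partOn S p * partOff S p = p := by
  classical
  have hd : partOn S p ∣ p := by
    refine dvd_trans ?_ (prod_multiset_X_sub_C_dvd p)
    exact Multiset.prod_dvd_prod_of_le (Multiset.map_le_map (Multiset.filter_le _ _))
  have hm : (partOn S p).Monic := monic_multiset_prod_of_monic _ _ fun t _ => monic_X_sub_C t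
  unfold partOff
  have h := modByMonic_add_div p (partOn S p)
  rw [(modByMonic_eq_zero_iff_dvd hm).2 hd, zero_add] at h
  exact h

/-- The cofactor has no root in `S`. -/
theorem not_isRoot_partOff {K : Type*} [Field K] (S : Set K) (p : K[X]) (hp : p ≠ 0) (t : K)
    (ht : t ∈ S) : ¬ (partOff S p).IsRoot t := by
  classical
  intro hr
  have h := partOn_mul_partOff S p
  have hne : partOn S p * partOff S p ≠ 0 := by rwa [h]
  have h1 : (partOn S p).roots = p.roots.filter (fun t => t ∈ S) := roots_multiset_prod_X_sub_C _
  have h2 := roots_mul hne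
  rw [h, h1] at h2
  have h3 := congrArg (Multiset.count t) h2
  rw [Multiset.count_add, Multiset.count_filter, if_pos ht] at h3
  have h4 : 0 < (partOff S p).roots.count t :=
    Multiset.count_pos.2 ((mem_roots (right_ne_zero_of_mul hne)).2 hr)
  omega

/-- With `μ = P Q` the minimal polynomial of `u`, `P` split with all roots in `S` and `Q` without
root in `S`, this is the space `Ker Q(u)`. -/
noncomputable def spaceOff {K E : Type*} [Field K] [AddCommGroup E] [Module K E]
    (S : Set K) (u : Module.End K E) : Submodule K E :=
  LinearMap.ker (aeval u (partOff S (minpoly K u)))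

theorem mapsTo_spaceOff {K E : Type*} [Field K] [AddCommGroup E] [Module K E]
    (S : Set K) (u : Module.End K E) : ∀ x ∈ spaceOff S u, u x ∈ spaceOff S u := by
  intro x hx
  have hx' : aeval u (partOff S (minpoly K u)) x = 0 := hx
  have hc : aeval u (partOff S (minpoly K u)) * u = u * aeval u (partOff S (minpoly K u)) :=
    by
    have h1 := congrArg (aeval u) (mul_comm (partOff S (minpoly K u)) X)
    simpa only [map_mul, aeval_X] using h1
  have := congrArg (fun f : Module.End K E => f x) hc
  simp only [Module.End.mul_apply, hx', map_zero] at this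
  exact this

/-- The endomorphism of `spaceOff S u` induced by `u`: the part of `u` with no eigenvalue
in `S`. -/
noncomputable def endOff {K E : Type*} [Field K] [AddCommGroup E] [Module K E]
    (S : Set K) (u : Module.End K E) : Module.End K (spaceOff S u) :=
  u.restrict (mapsTo_spaceOff S u)

/-- `L` is the list of the elementary factors (the invariant factors) of `v`: the `P ∈ L` are monic
and nonconstant, each divides the next one, and `v` is similar to the direct sum of the companion
endomorphisms of the `P ∈ L`. The companion endomorphism of `P` is the multiplication by the class
of `X` on `K[X] / (P)`, whose matrix in the basis `1, X, X², …` is the companion matrix of `P`. -/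
def IsElementaryFactors {K F : Type*} [Field K] [AddCommGroup F] [Module K F]
    (v : Module.End K F) (L : List K[X]) : Prop :=
  (∀ P ∈ L, P.Monic ∧ 0 < P.natDegree) ∧
  L.Pairwise (fun P Q => P ∣ Q) ∧
  ∃ e : F ≃ₗ[K] ((i : Fin L.length) → AdjoinRoot (L.get i)),
    ∀ (x : F) (i : Fin L.length), e (v x) i = AdjoinRoot.root (L.get i) * e x i

/-- The dimension of the kernel of the multiplication by `q` on `K[X] / (d)`. -/
noncomputable def kerDim {K : Type*} [Field K] (q d : K[X]) : ℕ :=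
  Module.finrank K (LinearMap.ker (LinearMap.mulLeft K (AdjoinRoot.mk d q)))

theorem kerDim_le {K : Type*} [Field K] (q d : K[X]) (hd : d.Monic) :
    kerDim q d ≤ d.natDegree := by
  have := (AdjoinRoot.powerBasis hd.ne_zero).finite
  have h := Submodule.finrank_le (LinearMap.ker (LinearMap.mulLeft K (AdjoinRoot.mk d q)))
  rwa [(AdjoinRoot.powerBasis hd.ne_zero).finrank, AdjoinRoot.powerBasis_dim] at h

theorem kerDim_eq_iff {K : Type*} [Field K] (q d : K[X]) (hd : d.Monic) :
    kerDim q d = d.natDegree ↔ d ∣ q := by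
  have := (AdjoinRoot.powerBasis hd.ne_zero).finite
  have hr : Module.finrank K (AdjoinRoot d) = d.natDegree := by
    rw [(AdjoinRoot.powerBasis hd.ne_zero).finrank, AdjoinRoot.powerBasis_dim]
  rw [← AdjoinRoot.mk_eq_zero, ← hr, kerDim]
  constructor
  · intro h
    have ht := Submodule.eq_top_of_finrank_eq h
    have : (1 : AdjoinRoot d) ∈ LinearMap.ker (LinearMap.mulLeft K (AdjoinRoot.mk d q)) := by
      rw [ht]; trivial
    simpa using this
  · intro h
    rw [h, LinearMap.mulLeft_zero_eq_zero, LinearMap.ker_zero, finrank_top]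

theorem list_unique {K : Type*} [Field K] : ∀ L L' : List K[X],
    (∀ P ∈ L, P.Monic ∧ 0 < P.natDegree) → (∀ P ∈ L', P.Monic ∧ 0 < P.natDegree) →
    L.Pairwise (fun P Q => Q ∣ P) → L'.Pairwise (fun P Q => Q ∣ P) →
    (∀ q, (L.map (kerDim q)).sum = (L'.map (kerDim q)).sum) → L = L' := by
  have h0 : ∀ d : K[X], d.Monic → kerDim 0 d = d.natDegree := fun d hd =>
    (kerDim_eq_iff 0 d hd).2 (dvd_zero d)
  have key : ∀ (A B : List K[X]) (d d' : K[X]), (∀ P ∈ A, P.Monic ∧ 0 < P.natDegree) →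
      (∀ P ∈ B, P.Monic ∧ 0 < P.natDegree) → (∀ P ∈ A, P ∣ d) → d' ∈ B →
      (∀ q, (A.map (kerDim q)).sum = (B.map (kerDim q)).sum) → d' ∣ d := by
    intro A B d d' hA hB hd hd' h
    have e1 : A.map (kerDim d) = A.map (kerDim 0) := List.map_congr_left fun P hP => by
      rw [h0 P (hA P hP).1, (kerDim_eq_iff d P (hA P hP).1).2 (hd P hP)]
    have e2 : (B.map (kerDim d)).sum = (B.map (kerDim 0)).sum := by rw [← h, ← h, e1]
    by_contra hn
    have : (B.map (kerDim d)).sum < (B.map (kerDim 0)).sum := by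
      refine List.sum_lt_sum _ _ (fun P hP => ?_) ⟨d', hd', ?_⟩
      · rw [h0 P (hB P hP).1]; exact kerDim_le _ _ (hB P hP).1
      · rw [h0 d' (hB d' hd').1]
        exact lt_of_le_of_ne (kerDim_le _ _ (hB d' hd').1)
          fun hh => hn ((kerDim_eq_iff d d' (hB d' hd').1).1 hh)
    omega
  intro L
  induction L with
  | nil =>
    intro L' _ hL' _ _ h
    cases L' with
    | nil => rfl
    | cons d' T =>
      have h1 := h 0
      have h2 := hL' d' (by simp)
      simp only [List.map_nil, List.sum_nil, List.map_cons, List.sum_cons, h0 d' h2.1] at h1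
      omega
  | cons d L ih =>
    intro L' hL hL' pL pL' h
    cases L' with
    | nil =>
      have h1 := h 0
      have h2 := hL d (by simp)
      simp only [List.map_nil, List.sum_nil, List.map_cons, List.sum_cons, h0 d h2.1] at h1
      omega
    | cons d' T =>
      have p1 := List.pairwise_cons.1 pL
      have p2 := List.pairwise_cons.1 pL'
      have hdd : d = d' := by
        refine eq_of_monic_of_associated (hL d (by simp)).1 (hL' d' (by simp)).1
          (associated_of_dvd_dvd ?_ ?_)
        · refine key (d' :: T) (d :: L) d' d hL' hL ?_ (by simp) fun q => (h q).symm
          intro P hP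
          rcases List.mem_cons.1 hP with rfl | hP
          · exact dvd_rfl
          · exact p2.1 P hP
        · refine key (d :: L) (d' :: T) d d' hL hL' ?_ (by simp) h
          intro P hP
          rcases List.mem_cons.1 hP with rfl | hP
          · exact dvd_rfl
          · exact p1.1 P hP
      subst hdd
      rw [ih T (fun P hP => hL P (by simp [hP])) (fun P hP => hL' P (by simp [hP])) p1.2 p2.2]
      intro q
      have := h q
      simp only [List.map_cons, List.sum_cons] at this
      omega

theorem IsElementaryFactors.finrank_ker {K F : Type*} [Field K] [AddCommGroup F]
    [Module K F] {v : Module.End K F} {L : List K[X]} (h : IsElementaryFactors v L) (q : K[X]) :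
    Module.finrank K (LinearMap.ker (aeval v q)) = (L.map (kerDim q)).sum := by
  obtain ⟨hL, -, e, he⟩ := h
  have hq : ∀ (q : K[X]) (x : F) (i : Fin L.length),
      e (aeval v q x) i = AdjoinRoot.mk (L.get i) q * e x i := by
    intro q
    induction q using Polynomial.induction_on' with
    | add p q hp hq => intro x i; simp [hp, hq, add_mul]
    | monomial n a =>
      intro x i
      have hn : ∀ (n : ℕ) (x : F), e ((v ^ n) x) i = AdjoinRoot.root (L.get i) ^ n * e x i := by
        intro n
        induction n with
        | zero => intro x; simp
        | succ n ih => intro x; rw [pow_succ, Module.End.mul_apply, ih, he]; ring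
      rw [← C_mul_X_pow_eq_monomial, map_mul, map_pow, aeval_C, aeval_X, map_mul, map_pow,
        AdjoinRoot.mk_X, AdjoinRoot.mk_C, Module.End.mul_apply, Module.algebraMap_end_apply,
        map_smul, Pi.smul_apply, hn, Algebra.smul_def, mul_assoc]
      rfl
  have : ∀ i : Fin L.length, Module.Finite K (AdjoinRoot (L.get i)) := fun i =>
    (AdjoinRoot.powerBasis (hL _ (L.get_mem i)).1.ne_zero).finite
  let f : LinearMap.ker (aeval v q) ≃ₗ[K] ((i : Fin L.length) →
      LinearMap.ker (LinearMap.mulLeft K (AdjoinRoot.mk (L.get i) q))) :=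
    { toFun := fun x i => ⟨e x.1 i, by
        have h1 := hq q x.1 i
        rw [show aeval v q x.1 = 0 from x.2] at h1
        simpa using h1.symm⟩
      map_add' := fun x y => by ext i; simp
      map_smul' := fun c x => by ext i; simp
      invFun := fun y => ⟨e.symm fun i => (y i).1, by
        rw [LinearMap.mem_ker, ← e.map_eq_zero_iff]
        ext i
        rw [hq, e.apply_symm_apply]
        exact (y i).2⟩
      left_inv := fun x => by ext; simp
      right_inv := fun y => by ext i; simp }
  rw [f.finrank_eq, Module.finrank_pi_fintype, ← List.sum_ofFn]
  congr 1
  apply List.ext_get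
  · simp
  · intro n h1 h2
    simp [kerDim]

/-- An endomorphism has at most one list of elementary factors. -/
theorem IsElementaryFactors.unique {K F : Type*} [Field K] [AddCommGroup F]
    [Module K F] {v : Module.End K F} {L L' : List K[X]} (h : IsElementaryFactors v L)
    (h' : IsElementaryFactors v L') : L = L' := by
  apply List.reverse_injective
  refine list_unique _ _ (fun P hP => h.1 P (by simpa using hP))
    (fun P hP => h'.1 P (by simpa using hP)) (List.pairwise_reverse.2 h.2.1)
    (List.pairwise_reverse.2 h'.2.1) fun q => ?_
  rw [List.map_reverse, List.map_reverse, List.sum_reverse, List.sum_reverse, ← h.finrank_ker,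
    ← h'.finrank_ker]

/-- An even polynomial is a polynomial in `X²`. -/
def IsEvenPoly {K : Type*} [Field K] (P : K[X]) : Prop :=
  ∃ Q : K[X], P = Q.comp (X ^ 2)

end Composite

namespace Composite

open Polynomial

/-! ### Annihilators and cyclic direct summands -/

section Cyclic

variable {K F : Type*} [Field K] [AddCommGroup F] [Module K F]

/-! Everything passes through one reformulation (`isComposite_iff_hasSkewRoot`): `u = α(p - q)` with
`p, q` idempotent exactly when some `v` satisfies `uv = -vu` and `v² = α² - u²`. Since `v²` is a
polynomial in `u`, such a `v` is a square root that reverses the sign of `u`.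

Necessity. On `Ker Q(u)` the operator `α² - u²` is injective, hence so is `v`, which therefore
conjugates `u` to `-u`. Uniqueness of the elementary factors makes each of them invariant under `X ↦
-X` up to sign, and injectivity of `u` there fixes the sign: the factors are even. At `±α`, `v`
exchanges the two generalized eigenspaces. Since `v² = -(u - α)(u + α)` and one factor is invertible
on each of them, kernels of `(u ∓ α)^k` there are kernels of `v^(2k)`. The growth of `Ker v^j` on
one side is controlled by its growth one step earlier on the other side (`finrank_ker_pow_inf_le`),
and summing two consecutive steps gives intertwining.

Sufficiency. On a cyclic module `K[X]/(P)` try `v : f(X) ↦ c(X) f(-X)`. It anticommutes with `X`,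
its square is multiplication by `c(X)c(-X)`, and it is well defined when `P ∣ c(X)P(-X)`. For even
`P` take `c = α - X`. For `P` with roots in `{0, α, -α}`, one of `c = α - X`, `c = α + X` works as
soon as the multiplicities of `α` and `-α` differ by at most one. Intertwining says precisely this
for every elementary factor, because Jordan numbers count the factors of large multiplicity and the
factors form a divisibility chain. -/

theorem aeval_restrict_apply {W : Submodule K F} {u : Module.End K F} (h : ∀ x ∈ W, u x ∈ W)
    (q : K[X]) (x : W) : (aeval (u.restrict h) q x : F) = aeval u q x := by
  induction q using Polynomial.induction_on' with
  | add p q hp hq => simp [hp, hq]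
  | monomial n a =>
    have hn : ∀ n : ℕ, (((u.restrict h) ^ n) x : F) = (u ^ n) x := by
      intro n
      induction n with
      | zero => simp
      | succ n ih => rw [pow_succ', pow_succ', Module.End.mul_apply, Module.End.mul_apply, ← ih]; rfl
    simp [aeval_monomial, hn]

/-- A linear map to a product of cyclic modules that is compatible with multiplication by `X` is
compatible with multiplication by all polynomials. -/
theorem equivariant_aeval {ι : Type*} {P : ι → K[X]} {u : Module.End K F}
    (e : F →ₗ[K] ((i : ι) → AdjoinRoot (P i)))
    (he : ∀ x i, e (u x) i = AdjoinRoot.root (P i) * e x i) (q : K[X]) (x : F) (i : ι) :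
    e (aeval u q x) i = AdjoinRoot.mk (P i) q * e x i := by
  induction q using Polynomial.induction_on' generalizing x with
  | add p q hp hq => simp [hp, hq, add_mul]
  | monomial n a =>
    have hn : ∀ (n : ℕ) (x : F), e ((u ^ n) x) i = AdjoinRoot.root (P i) ^ n * e x i := by
      intro n
      induction n with
      | zero => intro x; simp
      | succ n ih => intro x; rw [pow_succ, Module.End.mul_apply, ih, he]; ring
    rw [← C_mul_X_pow_eq_monomial, map_mul, map_pow, aeval_C, aeval_X, map_mul, map_pow,
      AdjoinRoot.mk_X, AdjoinRoot.mk_C, Module.End.mul_apply, Module.algebraMap_end_apply,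
      map_smul, Pi.smul_apply, hn, Algebra.smul_def, mul_assoc]
    rfl

theorem dvd_of_aeval_eq_zero {ι : Type*} {P : ι → K[X]} {u : Module.End K F}
    (e : F ≃ₗ[K] ((i : ι) → AdjoinRoot (P i)))
    (he : ∀ x i, e (u x) i = AdjoinRoot.root (P i) * e x i) {q : K[X]} (hq : aeval u q = 0)
    (i : ι) : P i ∣ q := by
  have h := equivariant_aeval e.toLinearMap he q (e.symm fun _ => 1) i
  rw [hq] at h
  simpa using h.symm

/-- A vector whose annihilator is generated by `d`, for every divisor `d` of the minimal
polynomial. -/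
theorem exists_annihilator_eq [FiniteDimensional K F] (u : Module.End K F) (d : K[X])
    (hd : d ∣ minpoly K u) : ∃ x, aeval u d x = 0 ∧ ∀ f, aeval u f x = 0 → d ∣ f := by
  classical
  have hμ : minpoly K u ≠ 0 := minpoly.ne_zero (Algebra.IsIntegral.isIntegral u)
  have hmul : ∀ (f g : K[X]) (x : F), aeval u (f * g) x = aeval u f (aeval u g x) := by
    intro f g x; rw [map_mul, Module.End.mul_apply]
  induction d using UniqueFactorizationMonoid.induction_on_coprime with
  | h0 => exact absurd (zero_dvd_iff.1 hd) hμ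
  | h1 hx => exact ⟨0, by simp, fun f _ => hx.dvd⟩
  | @hpr p i hp =>
    rcases i with _ | i
    · exact ⟨0, by simp, fun f _ => by simp⟩
    obtain ⟨r, hr⟩ := hd
    -- The minimal polynomial is `p ^ (i + 1) * r`; by minimality its divisor with one factor `p`
    -- fewer does not kill `u`.
    have hne : aeval u (p ^ i * r) ≠ 0 := by
      intro h0
      obtain ⟨s, hs⟩ := minpoly.dvd K u h0
      have h1 : p ^ i * r * 1 = p ^ i * r * (p * s) := by
        rw [mul_one]
        conv_lhs => rw [hs, hr]
        ring
      have h2 : p ^ i * r ≠ 0 := by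
        intro h; apply hμ; rw [hr, pow_succ', mul_assoc, h, mul_zero]
      exact hp.not_isUnit (IsUnit.of_mul_eq_one _ (mul_left_cancel₀ h2 h1).symm)
    obtain ⟨y, hy⟩ : ∃ y, aeval u (p ^ i * r) y ≠ 0 := by
      by_contra! h
      exact hne (LinearMap.ext h)
    refine ⟨aeval u r y, ?_, fun f hf => ?_⟩
    · rw [← hmul, ← hr, minpoly.aeval]; rfl
    -- By Bézout the gcd also kills the vector. It is associated to some `p ^ j`, and `j ≤ i` would
    -- contradict the choice of `y`.
    · have hg : aeval u (EuclideanDomain.gcd f (p ^ (i + 1))) (aeval u r y) = 0 := by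
        rw [EuclideanDomain.gcd_eq_gcd_ab, map_add, LinearMap.add_apply, mul_comm, hmul, hf,
          mul_comm (p ^ (i + 1)), hmul _ (p ^ (i + 1)), ← hmul (p ^ (i + 1)), ← hr, minpoly.aeval]
        simp
      obtain ⟨j, hj, hj'⟩ := (dvd_prime_pow hp _).1 (EuclideanDomain.gcd_dvd_right f (p ^ (i + 1)))
      rcases hj.eq_or_lt with rfl | hlt
      · exact hj'.symm.dvd.trans (EuclideanDomain.gcd_dvd_left _ _)
      · exfalso
        obtain ⟨s, hs⟩ := hj'.dvd.trans (pow_dvd_pow p (Nat.lt_succ_iff.1 hlt))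
        apply hy
        rw [hmul, hs, mul_comm, hmul, hg, map_zero]
  | @hcp a b hab iha ihb =>
    obtain ⟨x, hx, hx'⟩ := iha ((dvd_mul_right a b).trans hd)
    obtain ⟨y, hy, hy'⟩ := ihb ((dvd_mul_left b a).trans hd)
    have hab' : IsCoprime a b := hab.isCoprime
    refine ⟨x + y, ?_, fun f hf => hab'.mul_dvd ?_ ?_⟩
    · rw [map_add, hmul a b y, hy, map_zero, add_zero, mul_comm, hmul, hx, map_zero]
    · refine hab'.dvd_of_dvd_mul_left (hx' _ ?_)
      have : aeval u (b * f) (x + y) = 0 := by rw [hmul, hf, map_zero]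
      rwa [map_add, mul_comm b f, hmul f b y, hy, map_zero, add_zero, mul_comm] at this
    · refine hab'.symm.dvd_of_dvd_mul_left (hy' _ ?_)
      have : aeval u (a * f) (x + y) = 0 := by rw [hmul, hf, map_zero]
      rwa [map_add, mul_comm a f, hmul f a x, hx, map_zero, zero_add, mul_comm] at this

/-- A linear form on `K[X] / (P)` whose kernel contains no nonzero ideal. -/
theorem exists_nondegenerate_form {P : K[X]} (hP : P.Monic) :
    ∃ ψ : AdjoinRoot P →ₗ[K] K, ∀ a, (∀ b, ψ (b * a) = 0) → a = 0 := by
  -- The form reads the coefficient of degree `deg P - 1` of the reduced representative. A suitable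
  -- power of `X` moves the leading coefficient of a nonzero representative to that place without
  -- any reduction modulo `P`.
  refine ⟨(lcoeff K (P.natDegree - 1)).comp (AdjoinRoot.modByMonicHom hP), fun a ha => ?_⟩
  by_contra hne
  obtain ⟨f, rfl⟩ := AdjoinRoot.mk_surjective a
  set g := f %ₘ P
  have hfg : AdjoinRoot.mk P f = AdjoinRoot.mk P g := by
    have := AdjoinRoot.mk_leftInverse hP (AdjoinRoot.mk P f)
    rw [AdjoinRoot.modByMonicHom_mk] at this
    exact this.symm
  have hg0 : g ≠ 0 := by rintro h; rw [hfg, h, map_zero] at hne; exact hne rfl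
  have hdeg : g.degree < P.degree := degree_modByMonic_lt f hP
  have hnd : g.natDegree < P.natDegree := natDegree_lt_natDegree hg0 hdeg
  have h1 := ha (AdjoinRoot.mk P (X ^ (P.natDegree - 1 - g.natDegree)))
  rw [hfg, ← map_mul, LinearMap.comp_apply, AdjoinRoot.modByMonicHom_mk,
    (modByMonic_eq_self_iff hP).2, lcoeff_apply, coeff_X_pow_mul',
    if_pos (by omega)] at h1
  · rw [show P.natDegree - 1 - (P.natDegree - 1 - g.natDegree) = g.natDegree by omega] at h1
    exact hg0 (leadingCoeff_eq_zero.1 h1)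
  · refine degree_lt_degree ?_
    rw [natDegree_X_pow_mul _ hg0]
    omega

/-- A cyclic subspace of maximal dimension splits off. -/
theorem exists_cyclic_split [FiniteDimensional K F] (u : Module.End K F) :
    ∃ (C : Submodule K F) (hC : ∀ x ∈ C, u x ∈ C)
      (e : F ≃ₗ[K] AdjoinRoot (minpoly K u) × C), ∀ x,
        (e (u x)).1 = AdjoinRoot.root (minpoly K u) * (e x).1 ∧
        (e (u x)).2 = u.restrict hC (e x).2 := by
  set μ := minpoly K u
  have hμ : μ.Monic := minpoly.monic (Algebra.IsIntegral.isIntegral u)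
  obtain ⟨x, -, hx⟩ := exists_annihilator_eq u μ dvd_rfl
  let act : AdjoinRoot μ →ₗ[K] Module.End K F :=
    (aeval u).toLinearMap.comp (AdjoinRoot.modByMonicHom hμ)
  have act_mk : ∀ f, act (AdjoinRoot.mk μ f) = aeval u f := by
    intro f
    change aeval u (AdjoinRoot.modByMonicHom hμ (AdjoinRoot.mk μ f)) = _
    rw [AdjoinRoot.modByMonicHom_mk]
    exact aeval_modByMonic_eq_self_of_root (minpoly.aeval K u)
  have act_mul : ∀ a b, act (a * b) = act a * act b := by
    intro a b
    obtain ⟨f, rfl⟩ := AdjoinRoot.mk_surjective a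
    obtain ⟨g, rfl⟩ := AdjoinRoot.mk_surjective b
    rw [← map_mul, act_mk, act_mk, act_mk, map_mul]
  have act_root : act (AdjoinRoot.root μ) = u := by rw [← AdjoinRoot.mk_X, act_mk, aeval_X]
  let ι : AdjoinRoot μ →ₗ[K] F := act.flip x
  have hι : LinearMap.ker ι = ⊥ := by
    rw [LinearMap.ker_eq_bot']
    intro a ha
    obtain ⟨f, rfl⟩ := AdjoinRoot.mk_surjective a
    have : aeval u f x = 0 := by rw [← act_mk]; exact ha
    exact AdjoinRoot.mk_eq_zero.2 (hx f this)
  obtain ⟨r, hr⟩ := LinearMap.exists_leftInverse_of_injective ι hι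
  obtain ⟨ψ, hψ⟩ := exists_nondegenerate_form hμ
  have hfin := (AdjoinRoot.powerBasis hμ.ne_zero).finite
  have hrι : ∀ a, r (ι a) = a := fun a => LinearMap.congr_fun hr a
  -- The stable complement is the orthogonal of the cyclic subspace generated by `x`, for the
  -- pairing `(a, y) ↦ ψ (r (a • y))`. Nondegeneracy of `ψ` makes the intersection zero.
  let C : Submodule K F := ⨅ a : AdjoinRoot μ, LinearMap.ker (ψ ∘ₗ r ∘ₗ act a)
  have memC : ∀ y, y ∈ C ↔ ∀ a, ψ (r (act a y)) = 0 := by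
    intro y; simp [C, Submodule.mem_iInf]
  have hC : ∀ y ∈ C, u y ∈ C := by
    intro y hy
    rw [memC] at hy ⊢
    intro a
    have := hy (a * AdjoinRoot.root μ)
    rwa [act_mul, act_root] at this
  have actι : ∀ a b, act a (ι b) = ι (a * b) := by
    intro a b
    change act a (act b x) = act (a * b) x
    rw [act_mul]; rfl
  let T : AdjoinRoot μ →ₗ[K] (AdjoinRoot μ →ₗ[K] K) := (LinearMap.mul K (AdjoinRoot μ)).flip.compr₂ ψ
  have Tapp : ∀ a b, T a b = ψ (b * a) := fun a b => rfl
  have hT : Function.Injective T := by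
    rw [← LinearMap.ker_eq_bot, LinearMap.ker_eq_bot']
    intro a ha
    exact hψ a fun b => by rw [← Tapp, ha]; rfl
  -- By equality of dimensions, every linear form on `K[X] / (μ)` is `b ↦ ψ (b * a)` for some `a`.
  -- This supplies the projection of any `y` onto the cyclic part.
  have hTs : Function.Surjective T :=
    (LinearMap.injective_iff_surjective_of_finrank_eq_finrank
      (Subspace.dual_finrank_eq (K := K) (V := AdjoinRoot μ)).symm).1 hT
  let g : AdjoinRoot μ × C →ₗ[K] F := ι.coprod C.subtype
  have gapp : ∀ z, g z = ι z.1 + z.2 := fun z => rfl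
  have hg : Function.Bijective g := by
    constructor
    · rw [← LinearMap.ker_eq_bot, LinearMap.ker_eq_bot']
      rintro ⟨a, c⟩ h
      rw [gapp] at h
      have hc : ι a ∈ C := by
        rw [eq_neg_of_add_eq_zero_left h]; exact C.neg_mem c.2
      have ha : a = 0 := hψ a fun b => by
        have := (memC _).1 hc b
        rwa [actι, hrι] at this
      subst ha
      rw [map_zero, zero_add] at h
      ext
      · rfl
      · exact h
    · intro y
      obtain ⟨a, ha⟩ := hTs (ψ ∘ₗ r ∘ₗ act.flip y)
      refine ⟨(a, ⟨y - ι a, (memC _).2 fun b => ?_⟩), by simp [gapp]⟩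
      have h := LinearMap.congr_fun ha b
      rw [Tapp] at h
      rw [map_sub, map_sub, map_sub, actι, hrι, h, sub_eq_zero]
      rfl
  refine ⟨C, hC, (LinearEquiv.ofBijective g hg).symm, ?_⟩
  intro y
  obtain ⟨z, rfl⟩ := (LinearEquiv.ofBijective g hg).surjective y
  have key : u (LinearEquiv.ofBijective g hg z) = LinearEquiv.ofBijective g hg
      (AdjoinRoot.root μ * z.1, u.restrict hC z.2) := by
    rw [LinearEquiv.ofBijective_apply, LinearEquiv.ofBijective_apply, gapp, gapp, map_add,
      ← actι, act_root]
    rfl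
  rw [key, LinearEquiv.symm_apply_apply, LinearEquiv.symm_apply_apply]
  exact ⟨rfl, rfl⟩

end Cyclic

/-! ### Existence of elementary factors and the substitution of `-X` -/

section Factors

/-- Cyclic decomposition of an endomorphism, the annihilators decreasing for divisibility. -/
theorem exists_cyclic_decomposition {K : Type*} [Field K] (n : ℕ) :
    ∀ (F : Type*) [AddCommGroup F] [Module K F] [FiniteDimensional K F] (u : Module.End K F),
      Module.finrank K F = n →
      ∃ (k : ℕ) (P : Fin k → K[X]) (e : F ≃ₗ[K] ((i : Fin k) → AdjoinRoot (P i))),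
        (∀ i, (P i).Monic ∧ 0 < (P i).natDegree) ∧ (∀ i j, i ≤ j → P j ∣ P i) ∧
        ∀ x i, e (u x) i = AdjoinRoot.root (P i) * e x i := by
  induction n using Nat.strong_induction_on with
  | _ n ih =>
  intro F _ _ _ u hn
  rcases subsingleton_or_nontrivial F with hF | hF
  · refine ⟨0, Fin.elim0, LinearEquiv.ofSubsingleton _ _, fun i => i.elim0, fun i => i.elim0,
      fun x i => i.elim0⟩
  obtain ⟨C, hC, e, he⟩ := exists_cyclic_split u
  have hint : IsIntegral K u := Algebra.IsIntegral.isIntegral u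
  have hμ : (minpoly K u).Monic := minpoly.monic hint
  have hdeg : 0 < (minpoly K u).natDegree := minpoly.natDegree_pos hint
  have hlt : Module.finrank K C < n := by
    have hfin := (AdjoinRoot.powerBasis hμ.ne_zero).finite
    rw [← hn, e.finrank_eq, Module.finrank_prod, (AdjoinRoot.powerBasis hμ.ne_zero).finrank,
      AdjoinRoot.powerBasis_dim]
    omega
  obtain ⟨k, P, f, hP, hdvd, hf⟩ := ih _ hlt C (u.restrict hC) rfl
  have hPμ : ∀ i, P i ∣ minpoly K u := dvd_of_aeval_eq_zero f hf (by
    ext x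
    rw [aeval_restrict_apply, minpoly.aeval]
    rfl)
  let Q : Fin (k + 1) → K[X] := Fin.cons (minpoly K u) P
  let g : F ≃ₗ[K] ((i : Fin (k + 1)) → AdjoinRoot (Q i)) :=
    (e.trans ((LinearEquiv.refl K _).prodCongr f)).trans
      (Fin.consLinearEquiv K (fun i => AdjoinRoot (Q i)))
  have g0 : ∀ x, g x 0 = (e x).1 := fun x => rfl
  have gs : ∀ x i, g x (Fin.succ i) = f (e x).2 i := fun x i => rfl
  refine ⟨k + 1, Q, g, ?_, ?_, ?_⟩
  · intro i
    refine Fin.cases ⟨hμ, hdeg⟩ (fun i => hP i) i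
  · intro i j
    refine Fin.cases (fun _ => ?_) (fun i => ?_) i
    · exact Fin.cases dvd_rfl (fun j => hPμ j) j
    · refine Fin.cases (fun h => ?_) (fun j h => hdvd i j (Fin.succ_le_succ_iff.1 h)) j
      exact absurd h (by simp)
  · intro x i
    refine Fin.cases ?_ (fun i => ?_) i
    · rw [g0, g0, (he x).1]; rfl
    · rw [gs, gs, (he x).2, hf]; rfl

/-- Recognition of a list of elementary factors from a family indexed by another type. -/
theorem isElementaryFactors_of_equiv {K F ι : Type*} [Field K] [AddCommGroup F]
    [Module K F] {v : Module.End K F} {P : ι → K[X]} (e : F ≃ₗ[K] ((i : ι) → AdjoinRoot (P i)))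
    (he : ∀ x i, e (v x) i = AdjoinRoot.root (P i) * e x i) {L : List K[X]}
    (hL : ∀ P ∈ L, P.Monic ∧ 0 < P.natDegree) (hL' : L.Pairwise (fun P Q => P ∣ Q))
    (σ : Fin L.length ≃ ι) (hσ : ∀ i, P (σ i) = L.get i) : IsElementaryFactors v L := by
  refine ⟨hL, hL', (e.trans (LinearEquiv.piCongrLeft' K _ σ.symm)).trans
    (LinearEquiv.piCongrRight fun i => (AdjoinRoot.algEquivOfEq K _ _ (hσ i)).toLinearEquiv), ?_⟩
  intro x i
  change AdjoinRoot.algEquivOfEq K _ _ (hσ i) (e (v x) (σ i)) =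
    _ * AdjoinRoot.algEquivOfEq K _ _ (hσ i) (e x (σ i))
  rw [he, map_mul, AdjoinRoot.algEquivOfEq_root]

theorem exists_isElementaryFactors {K F : Type*} [Field K] [AddCommGroup F] [Module K F]
    [FiniteDimensional K F] (v : Module.End K F) : ∃ L, IsElementaryFactors v L := by
  obtain ⟨k, P, e, hP, hdvd, he⟩ := exists_cyclic_decomposition (K := K) _ F v rfl
  -- Splitting off the minimal polynomial first yields decreasing annihilators, so the order is
  -- reversed.
  refine ⟨List.ofFn fun i => P i.rev, isElementaryFactors_of_equiv e he ?_ ?_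
    ((finCongr List.length_ofFn).trans Fin.revPerm) ?_⟩
  · intro Q hQ
    obtain ⟨i, rfl⟩ := (List.mem_ofFn' _ _).1 hQ
    exact hP _
  · rw [List.pairwise_ofFn]
    intro i j hij
    exact hdvd _ _ (Fin.rev_le_rev.2 hij.le)
  · intro i
    simp [Fin.cast]

/-- The substitution of `-X`, normalized so as to preserve monic polynomials. -/
noncomputable def negTwist {K : Type*} [Field K] (P : K[X]) : K[X] :=
  C ((-1) ^ P.natDegree) * P.comp (-X)

theorem comp_negX_natDegree {K : Type*} [Field K] (P : K[X]) :
    (P.comp (-X)).natDegree = P.natDegree := by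
  rw [natDegree_comp, natDegree_neg, natDegree_X, mul_one]

theorem associated_negTwist {K : Type*} [Field K] (P : K[X]) :
    Associated (P.comp (-X)) (negTwist P) := by
  have : IsUnit (C ((-1 : K) ^ P.natDegree)) := isUnit_C.2 ((isUnit_one.neg).pow _)
  exact (associated_isUnit_mul_left_iff this).2 (Associated.refl _) |>.symm

theorem negTwist_natDegree {K : Type*} [Field K] (P : K[X]) :
    (negTwist P).natDegree = P.natDegree := by
  rw [negTwist, natDegree_C_mul (pow_ne_zero _ (neg_ne_zero.2 one_ne_zero)), comp_negX_natDegree]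

theorem negTwist_monic {K : Type*} [Field K] {P : K[X]} (hP : P.Monic) : (negTwist P).Monic := by
  rw [Monic, leadingCoeff, negTwist_natDegree, negTwist, coeff_C_mul]
  have h : (P.comp (-X)).coeff P.natDegree = (-1) ^ P.natDegree * P.coeff P.natDegree := by
    conv_lhs => rw [← comp_negX_natDegree P]
    rw [coeff_natDegree, leadingCoeff_comp (by simp), hP.leadingCoeff, leadingCoeff_neg,
      leadingCoeff_X, hP.coeff_natDegree]
    ring
  rw [h, hP.coeff_natDegree, mul_one, ← mul_pow]
  simp

/-- The isomorphism `K[X] / (P(X)) ≃ K[X] / (P(-X))` induced by `X ↦ -X`. -/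
theorem exists_adjoinRoot_negTwist {K : Type*} [Field K] (P : K[X]) :
    ∃ e : AdjoinRoot P ≃ₐ[K] AdjoinRoot (negTwist P),
      e (AdjoinRoot.root P) = -AdjoinRoot.root (negTwist P) := by
  have h1 : P.eval₂ (Algebra.ofId K (AdjoinRoot (negTwist P)) : K →+* _)
      (-AdjoinRoot.root (negTwist P)) = 0 := by
    have : AdjoinRoot.mk (negTwist P) (P.comp (-X)) = 0 :=
      AdjoinRoot.mk_eq_zero.2 (associated_negTwist P).symm.dvd
    rw [← AdjoinRoot.aeval_eq, aeval_comp, map_neg, aeval_X] at this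
    exact this
  have h2 : (negTwist P).eval₂ (Algebra.ofId K (AdjoinRoot P) : K →+* _)
      (-AdjoinRoot.root P) = 0 := by
    have : aeval (-AdjoinRoot.root P) (negTwist P) = 0 := by
      rw [negTwist, map_mul, aeval_comp, map_neg, aeval_X, neg_neg, AdjoinRoot.aeval_eq,
        AdjoinRoot.mk_self, mul_zero]
    exact this
  refine ⟨AlgEquiv.ofAlgHom (AdjoinRoot.liftAlgHom P (Algebra.ofId K _) _ h1)
    (AdjoinRoot.liftAlgHom (negTwist P) (Algebra.ofId K _) _ h2) ?_ ?_, ?_⟩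
  · apply AdjoinRoot.algHom_ext; simp
  · apply AdjoinRoot.algHom_ext; simp
  · simp

theorem IsElementaryFactors.neg {K F : Type*} [Field K] [AddCommGroup F] [Module K F]
    {v : Module.End K F} {L : List K[X]} (h : IsElementaryFactors v L) :
    IsElementaryFactors (-v) (L.map negTwist) := by
  obtain ⟨hL, hL', e, he⟩ := h
  choose t ht using fun i : Fin L.length => exists_adjoinRoot_negTwist (L.get i)
  refine isElementaryFactors_of_equiv (P := fun i : Fin L.length => negTwist (L.get i))
    (e.trans (LinearEquiv.piCongrRight fun i => (t i).toLinearEquiv)) ?_ ?_ ?_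
    (finCongr (by simp)) ?_
  · intro x i
    change t i (e (-v x) i) = _ * t i (e x i)
    rw [map_neg, Pi.neg_apply, he, map_neg, map_mul, ht, neg_mul, neg_neg]
  · intro Q hQ
    obtain ⟨P, hP, rfl⟩ := List.mem_map.1 hQ
    exact ⟨negTwist_monic (hL P hP).1, by rw [negTwist_natDegree]; exact (hL P hP).2⟩
  · rw [List.pairwise_map]
    refine hL'.imp fun {P Q} hPQ => ?_
    obtain ⟨R, rfl⟩ := hPQ
    refine (associated_negTwist P).symm.dvd.trans (dvd_trans ?_ (associated_negTwist _).dvd)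
    rw [mul_comp]
    exact dvd_mul_right _ _
  · intro i; simp

theorem IsElementaryFactors.conj {K F : Type*} [Field K] [AddCommGroup F] [Module K F]
    {v w : Module.End K F} {L : List K[X]} (h : IsElementaryFactors v L) (s : F ≃ₗ[K] F)
    (hs : ∀ x, s (w x) = v (s x)) : IsElementaryFactors w L := by
  obtain ⟨hL, hL', e, he⟩ := h
  exact ⟨hL, hL', s.trans e, fun x i => by
    rw [LinearEquiv.trans_apply, LinearEquiv.trans_apply, hs, he]⟩

theorem comp_negX_coeff {K : Type*} [Field K] (P : K[X]) (n : ℕ) :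
    (P.comp (-X)).coeff n = (-1) ^ n * P.coeff n := by
  have : P.comp (-X) = P.comp (C (-1) * X) := by simp
  rw [this, comp_C_mul_X_coeff, mul_comm]

/-- An endomorphism without kernel that is similar to its opposite has even elementary factors. -/
theorem IsElementaryFactors.isEvenPoly {K F : Type*} [Field K] [AddCommGroup F] [Module K F]
    {v : Module.End K F} {L : List K[X]} (h : IsElementaryFactors v L) (hK : (2 : K) ≠ 0)
    (hv : Function.Injective v) (s : F ≃ₗ[K] F) (hs : ∀ x, s (v x) = -v (s x)) :
    ∀ P ∈ L, IsEvenPoly P := by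
  intro P hP
  have h1 : L.map negTwist = L := (h.neg.conj s hs).unique h
  have h2 : negTwist P = P := List.map_inj_left.1 (h1.trans (List.map_id L).symm) P hP
  have h3 : P.coeff 0 ≠ 0 := by
    intro h0
    obtain ⟨hL, -, e, he⟩ := h
    obtain ⟨i, rfl⟩ := List.get_of_mem hP
    obtain ⟨R, hR⟩ := X_dvd_iff.2 h0
    have hz : AdjoinRoot.root (L.get i) * AdjoinRoot.mk (L.get i) R = 0 := by
      rw [← AdjoinRoot.mk_X, ← map_mul, ← hR, AdjoinRoot.mk_self]
    have hne : L.get i ≠ 0 := (hL _ hP).1.ne_zero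
    -- If `X` divided a factor `P = X * R`, the class of `R` in that summand would be a nonzero
    -- vector of the kernel.
    have hx : v (e.symm (Pi.single i (AdjoinRoot.mk (L.get i) R))) = 0 := by
      rw [← e.map_eq_zero_iff]
      ext j
      rw [he, e.apply_symm_apply]
      rcases eq_or_ne j i with rfl | hji
      · rw [Pi.single_eq_same, hz]; rfl
      · rw [Pi.single_eq_of_ne hji, mul_zero]; rfl
    rw [← map_zero v] at hx
    have h4 := hv hx
    rw [e.symm.map_eq_zero_iff, Pi.single_eq_zero_iff, AdjoinRoot.mk_eq_zero] at h4
    obtain ⟨T, hT⟩ := h4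
    have : L.get i * (X * T) = L.get i * 1 := by
      rw [mul_one]; conv_rhs => rw [hR, hT]
      ring
    exact not_isUnit_X (IsUnit.of_mul_eq_one _ (mul_left_cancel₀ hne this))
  have h5 : ∀ n, (-1 : K) ^ P.natDegree * ((-1) ^ n * P.coeff n) = P.coeff n := by
    intro n
    conv_rhs => rw [← h2, negTwist, coeff_C_mul, comp_negX_coeff]
  -- The nonzero constant coefficient forces the normalizing sign to be `1`; odd coefficients are
  -- then equal to their opposites and vanish since `2 ≠ 0`.
  have h6 : (-1 : K) ^ P.natDegree = 1 := by
    have := h5 0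
    rw [pow_zero, one_mul] at this
    exact mul_right_cancel₀ h3 (this.trans (one_mul _).symm)
  refine ⟨contract 2 P, ?_⟩
  rw [← expand_eq_comp_X_pow]
  ext n
  rw [coeff_expand two_pos]
  split_ifs with hn
  · rw [coeff_contract two_ne_zero, Nat.div_mul_cancel hn]
  · have := h5 n
    rw [h6, one_mul, (Nat.not_even_iff_odd.1 fun hh => hn hh.two_dvd).neg_one_pow] at this
    have h7 : 2 * P.coeff n = 0 := by linear_combination -this
    exact (mul_eq_zero.1 h7).resolve_left hK

end Factors

/-! ### Reformulation by an anticommuting square root -/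

section SkewRoot

variable {K E : Type*} [Field K] [AddCommGroup E] [Module K E]

/-- `α² - u²` has a square root that anticommutes with `u`. -/
def HasSkewRoot (α : K) (u : Module.End K E) : Prop :=
  ∃ v : Module.End K E, u * v = -(v * u) ∧ v * v = algebraMap K (Module.End K E) (α ^ 2) - u * u

theorem isIdempotentElem_half_one_add {A : Type*} [Ring A] [Algebra K A] (hK : (2 : K) ≠ 0)
    {s : A} (hs : s * s = 1) : IsIdempotentElem ((2 : K)⁻¹ • (1 + s)) := by
  have h : (1 + s) * (1 + s) = (2 : K) • (1 + s) := by
    have : (1 + s) * (1 + s) = 1 + s + s + s * s := by noncomm_ring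
    rw [this, hs, two_smul]; abel
  rw [IsIdempotentElem, smul_mul_smul_comm, h, smul_smul, mul_assoc, inv_mul_cancel₀ hK, mul_one]

/-- From `p, q` one takes `v = α(p + q - 1)`. Conversely, anticommutation cancels the cross terms in
`(v ± u)²`, which both equal `α²`; so `α⁻¹(v ± u)` are involutions, and the associated projections
have difference `α⁻¹u`. -/
theorem isComposite_iff_hasSkewRoot (hK : (2 : K) ≠ 0) {α : K} (hα : α ≠ 0)
    (u : Module.End K E) : IsComposite α (-α) u ↔ HasSkewRoot α u := by
  constructor
  · rintro ⟨p, q, hp, hq, rfl⟩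
    have hp' : p * p = p := hp
    have hq' : q * q = q := hq
    have e : α • p + (-α) • q = α • (p - q) := by rw [smul_sub, neg_smul, sub_eq_add_neg]
    have h1 : (p - q) * (p + q - 1) = p * q - q * p := by
      have : (p - q) * (p + q - 1) = p * p - q * q + p * q - q * p - p + q := by noncomm_ring
      rw [this, hp', hq']; abel
    have h2 : (p + q - 1) * (p - q) = q * p - p * q := by
      have : (p + q - 1) * (p - q) = p * p - q * q - p * q + q * p - p + q := by noncomm_ring
      rw [this, hp', hq']; abel
    have h3 : (p + q - 1) * (p + q - 1) = 1 - (p - q) * (p - q) := by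
      have : (p + q - 1) * (p + q - 1) + (p - q) * (p - q)
          = 2 • (p * p) + 2 • (q * q) - 2 • p - 2 • q + 1 := by noncomm_ring
      rw [hp', hq'] at this
      rw [eq_sub_iff_add_eq, this]; abel
    refine ⟨α • (p + q - 1), ?_, ?_⟩
    · rw [e, smul_mul_smul_comm, smul_mul_smul_comm, h1, h2, ← smul_neg, neg_sub]
    · rw [e, smul_mul_smul_comm, smul_mul_smul_comm, h3, Algebra.algebraMap_eq_smul_one, sq,
        smul_sub]
  · rintro ⟨v, h1, h2⟩
    have hsq : ∀ w : Module.End K E, w * w = algebraMap K _ (α ^ 2) →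
        (α⁻¹ • w) * (α⁻¹ • w) = 1 := by
      intro w hw
      rw [smul_mul_smul_comm, hw, Algebra.algebraMap_eq_smul_one, smul_smul, ← mul_inv, ← sq,
        inv_mul_cancel₀ (pow_ne_zero 2 hα), one_smul]
    have ha : (v + u) * (v + u) = algebraMap K _ (α ^ 2) := by
      have : (v + u) * (v + u) = v * v + v * u + u * v + u * u := by noncomm_ring
      rw [this, h1, h2]; abel
    have hb : (v - u) * (v - u) = algebraMap K _ (α ^ 2) := by
      have : (v - u) * (v - u) = v * v - v * u - u * v + u * u := by noncomm_ring
      rw [this, h1, h2]; abel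
    refine ⟨_, _, isIdempotentElem_half_one_add hK (hsq _ ha),
      isIdempotentElem_half_one_add hK (hsq _ hb), ?_⟩
    rw [neg_smul, ← sub_eq_add_neg, ← smul_sub, ← smul_sub, add_sub_add_left_eq_sub, ← smul_sub,
      add_sub_sub_cancel, ← two_smul K u, smul_smul, smul_smul, smul_smul]
    have : α * 2⁻¹ * α⁻¹ * 2 = 1 := by field_simp
    rw [this, one_smul]

/-- On `K[X] / (P)`, the map `f(X) ↦ c(X) f(-X)` anticommutes with `X`. -/
theorem hasSkewRoot_of_cyclic_decomposition {ι : Type*} {P : ι → K[X]} {u : Module.End K E}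
    (e : E ≃ₗ[K] ((i : ι) → AdjoinRoot (P i)))
    (he : ∀ x i, e (u x) i = AdjoinRoot.root (P i) * e x i) (hP : ∀ i, (P i).Monic) (α : K)
    (hc : ∀ i, ∃ c : K[X], c * c.comp (-X) = C (α ^ 2) - X ^ 2 ∧ P i ∣ c * (P i).comp (-X)) :
    HasSkewRoot α u := by
  choose c hc hd using hc
  let s : K[X] →ₗ[K] K[X] := (aeval (-X : K[X])).toLinearMap
  have hs : ∀ f, s f = f.comp (-X) := fun f => (comp_eq_aeval).symm
  let w : (i : ι) → AdjoinRoot (P i) →ₗ[K] AdjoinRoot (P i) := fun i =>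
    (AdjoinRoot.mkₐ (P i)).toLinearMap ∘ₗ LinearMap.mulLeft K (c i) ∘ₗ s ∘ₗ
      AdjoinRoot.modByMonicHom (hP i)
  have hw : ∀ i f, w i (AdjoinRoot.mk (P i) f) = AdjoinRoot.mk (P i) (c i * f.comp (-X)) := by
    intro i f
    change AdjoinRoot.mk (P i) (c i * s (AdjoinRoot.modByMonicHom (hP i) (AdjoinRoot.mk (P i) f))) = _
    rw [AdjoinRoot.modByMonicHom_mk, hs, AdjoinRoot.mk_eq_mk]
    have h1 : f %ₘ P i = f - P i * (f /ₘ P i) := eq_sub_of_add_eq (modByMonic_add_div f (P i))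
    rw [h1, sub_comp, mul_comp]
    have : c i * (f.comp (-X) - (P i).comp (-X) * (f /ₘ P i).comp (-X)) - c i * f.comp (-X)
        = c i * (P i).comp (-X) * (-(f /ₘ P i).comp (-X)) := by ring
    -- Replacing `f` by its remainder changes the value by a multiple of `c(X) P(-X)`, hence of `P`.
    rw [this]
    exact (hd i).mul_right _
  have w1 : ∀ i a, AdjoinRoot.root (P i) * w i a = -w i (AdjoinRoot.root (P i) * a) := by
    intro i a
    obtain ⟨f, rfl⟩ := AdjoinRoot.mk_surjective a
    rw [← AdjoinRoot.mk_X, ← map_mul, hw, hw, ← map_mul, ← map_neg, mul_comp, X_comp]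
    congr 1; ring
  have w2 : ∀ i a, w i (w i a) =
      α ^ 2 • a - AdjoinRoot.root (P i) * (AdjoinRoot.root (P i) * a) := by
    intro i a
    obtain ⟨f, rfl⟩ := AdjoinRoot.mk_surjective a
    rw [← AdjoinRoot.mk_X, hw, hw, AdjoinRoot.smul_mk, ← map_mul, ← map_mul, ← map_sub, mul_comp,
      comp_neg_X_comp_neg_X, ← mul_assoc, hc, smul_eq_C_mul]
    congr 1; ring
  let W : Module.End K ((i : ι) → AdjoinRoot (P i)) := LinearMap.pi fun i => w i ∘ₗ LinearMap.proj i
  have hW : ∀ y i, W y i = w i (y i) := fun y i => rfl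
  let v : Module.End K E := e.symm.toLinearMap ∘ₗ W ∘ₗ e.toLinearMap
  have hv : ∀ x i, e (v x) i = w i (e x i) := by
    intro x i
    change e (e.symm (W (e x))) i = _
    rw [e.apply_symm_apply, hW]
  refine ⟨v, ?_, ?_⟩
  · ext x
    apply e.injective
    ext i
    rw [Module.End.mul_apply, he, hv, w1, LinearMap.neg_apply, Module.End.mul_apply, map_neg,
      Pi.neg_apply, hv, he]
  · ext x
    apply e.injective
    ext i
    rw [Module.End.mul_apply, hv, hv, w2, LinearMap.sub_apply, Module.End.mul_apply, map_sub,
      Pi.sub_apply, he, he, Module.algebraMap_end_apply, map_smul, Pi.smul_apply]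

theorem HasSkewRoot.of_isCompl {u : Module.End K E} {α : K} {W₁ W₂ : Submodule K E}
    (hW : IsCompl W₁ W₂) (h₁ : ∀ x ∈ W₁, u x ∈ W₁) (h₂ : ∀ x ∈ W₂, u x ∈ W₂)
    (H₁ : HasSkewRoot α (u.restrict h₁)) (H₂ : HasSkewRoot α (u.restrict h₂)) :
    HasSkewRoot α u := by
  obtain ⟨v₁, a₁, b₁⟩ := H₁
  obtain ⟨v₂, a₂, b₂⟩ := H₂
  let v : Module.End K E := LinearMap.ofIsCompl hW (W₁.subtype ∘ₗ v₁) (W₂.subtype ∘ₗ v₂)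
  have hv₁ : ∀ x : W₁, v x = v₁ x := fun x => LinearMap.ofIsCompl_apply_left hW x
  have hv₂ : ∀ x : W₂, v x = v₂ x := fun x => LinearMap.ofIsCompl_apply_right hW x
  have hu₁ : ∀ x : W₁, u x = u.restrict h₁ x := fun x => rfl
  have hu₂ : ∀ x : W₂, u x = u.restrict h₂ x := fun x => rfl
  have key : ∀ f g : Module.End K E, (∀ x : W₁, f x = g x) → (∀ x : W₂, f x = g x) → f = g := by
    intro f g hf hg
    ext x
    obtain ⟨y, hy, z, hz, rfl⟩ := Submodule.mem_sup.1
      (show x ∈ W₁ ⊔ W₂ by rw [hW.sup_eq_top]; trivial)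
    rw [map_add, map_add, hf ⟨y, hy⟩, hg ⟨z, hz⟩]
  refine ⟨v, key _ _ (fun x => ?_) fun x => ?_, key _ _ (fun x => ?_) fun x => ?_⟩
  · have := congrArg (Subtype.val) (LinearMap.congr_fun a₁ x)
    rw [Module.End.mul_apply, LinearMap.neg_apply, Module.End.mul_apply, hv₁, hu₁ (v₁ x), hu₁ x,
      hv₁]
    exact this
  · have := congrArg (Subtype.val) (LinearMap.congr_fun a₂ x)
    rw [Module.End.mul_apply, LinearMap.neg_apply, Module.End.mul_apply, hv₂, hu₂ (v₂ x), hu₂ x,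
      hv₂]
    exact this
  · have := congrArg (Subtype.val) (LinearMap.congr_fun b₁ x)
    rw [Module.End.mul_apply, LinearMap.sub_apply, Module.End.mul_apply, hv₁, hv₁, hu₁ x, hu₁]
    exact this
  · have := congrArg (Subtype.val) (LinearMap.congr_fun b₂ x)
    rw [Module.End.mul_apply, LinearMap.sub_apply, Module.End.mul_apply, hv₂, hv₂, hu₂ x, hu₂]
    exact this

theorem aeval_eq_zero_of_isCoprime {u : Module.End K E} {f A B : K[X]} {x : E}
    (hf : aeval u f x = 0) (hAB : aeval u (A * B) x = 0) (h : IsCoprime f B) :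
    aeval u A x = 0 := by
  obtain ⟨a, b, hab⟩ := h
  have : A = (A * a) * f + b * (A * B) := by linear_combination -A * hab
  rw [this, map_add, map_mul, map_mul _ b, LinearMap.add_apply, Module.End.mul_apply,
    Module.End.mul_apply, hf, hAB, map_zero, map_zero, add_zero]

theorem isCoprime_partOn {S : Set K} (p : K[X]) {g : K[X]} (hg : ∀ t ∈ S, ¬ g.IsRoot t) :
    IsCoprime (partOn S p) g := by
  classical
  refine Multiset.prod_induction (fun f => IsCoprime f g) _ (fun a b => IsCoprime.mul_left)
    isCoprime_one_left fun f hf => ?_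
  obtain ⟨t, ht, rfl⟩ := Multiset.mem_map.1 hf
  rw [(irreducible_X_sub_C t).coprime_iff_not_dvd, dvd_iff_isRoot]
  exact hg t (Multiset.mem_filter.1 ht).2

theorem isCompl_spaceOff [FiniteDimensional K E] (S : Set K) (u : Module.End K E) :
    IsCompl (LinearMap.ker (aeval u (partOn S (minpoly K u)))) (spaceOff S u) := by
  have hμ : minpoly K u ≠ 0 := minpoly.ne_zero (Algebra.IsIntegral.isIntegral u)
  have hc : IsCoprime (partOn S (minpoly K u)) (partOff S (minpoly K u)) :=
    isCoprime_partOn _ (not_isRoot_partOff S _ hμ)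
  refine ⟨disjoint_ker_aeval_of_isCoprime u hc, codisjoint_iff.2 ?_⟩
  have h := sup_ker_aeval_eq_ker_aeval_mul_of_coprime u hc
  rw [partOn_mul_partOff, minpoly.aeval, LinearMap.ker_zero] at h
  exact h

end SkewRoot

/-! ### Jordan numbers read on the elementary factors, and sufficiency -/

section Counting

variable {K E : Type*} [Field K] [AddCommGroup E] [Module K E]

/-- Since `q` is prime to `h`, the kernel is the ideal generated by `h` in `K[X] / (gh)`, a copy of
`K[X] / (g)`. -/
theorem kerDim_eq_natDegree {g h q : K[X]} (hg : g.Monic) (hh : h.Monic) (hqh : IsCoprime q h) :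
    kerDim (g * q) (g * h) = g.natDegree := by
  have hd : (g * h).Monic := hg.mul hh
  let φ : K[X] →ₗ[K] AdjoinRoot (g * h) :=
    (AdjoinRoot.mkₐ (g * h)).toLinearMap ∘ₗ LinearMap.mulLeft K h
  have hφ : ∀ f, φ f = AdjoinRoot.mk (g * h) (h * f) := fun f => rfl
  let ψ : AdjoinRoot g →ₗ[K] AdjoinRoot (g * h) := φ ∘ₗ AdjoinRoot.modByMonicHom hg
  have hψ : ∀ f, ψ (AdjoinRoot.mk g f) = AdjoinRoot.mk (g * h) (h * f) := by
    intro f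
    change φ (AdjoinRoot.modByMonicHom hg (AdjoinRoot.mk g f)) = _
    rw [AdjoinRoot.modByMonicHom_mk, hφ, AdjoinRoot.mk_eq_mk,
      show f %ₘ g = f - g * (f /ₘ g) from eq_sub_of_add_eq (modByMonic_add_div f g)]
    exact ⟨-(f /ₘ g), by ring⟩
  have hinj : Function.Injective ψ := by
    rw [← LinearMap.ker_eq_bot, LinearMap.ker_eq_bot']
    intro a ha
    obtain ⟨f, rfl⟩ := AdjoinRoot.mk_surjective a
    rw [hψ, AdjoinRoot.mk_eq_zero, mul_comm g] at ha
    exact AdjoinRoot.mk_eq_zero.2 ((mul_dvd_mul_iff_left hh.ne_zero).1 ha)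
  have hrange : LinearMap.range ψ =
      LinearMap.ker (LinearMap.mulLeft K (AdjoinRoot.mk (g * h) (g * q))) := by
    apply le_antisymm
    · rintro _ ⟨a, rfl⟩
      obtain ⟨f, rfl⟩ := AdjoinRoot.mk_surjective a
      rw [hψ, LinearMap.mem_ker, LinearMap.mulLeft_apply, ← map_mul, AdjoinRoot.mk_eq_zero]
      exact ⟨q * f, by ring⟩
    · intro b hb
      obtain ⟨f, rfl⟩ := AdjoinRoot.mk_surjective b
      rw [LinearMap.mem_ker, LinearMap.mulLeft_apply, ← map_mul, AdjoinRoot.mk_eq_zero, mul_assoc,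
        mul_dvd_mul_iff_left hg.ne_zero] at hb
      obtain ⟨r, rfl⟩ := hqh.symm.dvd_of_dvd_mul_left hb
      exact ⟨AdjoinRoot.mk g r, hψ r⟩
  rw [kerDim, ← hrange, LinearMap.finrank_range_of_inj hinj,
    (AdjoinRoot.powerBasis hg.ne_zero).finrank, AdjoinRoot.powerBasis_dim]

theorem kerDim_X_sub_C_pow (t : K) (k : ℕ) {d : K[X]} (hd : d.Monic) :
    kerDim ((X - C t) ^ k) d = min k (d.rootMultiplicity t) := by
  have hm : ∀ n, ((X - C t) ^ n).Monic := fun n => (monic_X_sub_C t).pow n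
  have hn : ∀ n, ((X - C t) ^ n).natDegree = n := fun n => by
    rw [natDegree_pow, natDegree_X_sub_C, mul_one]
  rcases le_total k (d.rootMultiplicity t) with hk | hk
  · obtain ⟨h, rfl⟩ := (le_rootMultiplicity_iff hd.ne_zero).1 hk
    rw [min_eq_left hk]
    have := kerDim_eq_natDegree (q := 1) (hm k) ((hm k).of_mul_monic_left hd) isCoprime_one_left
    rwa [mul_one, hn] at this
  · rw [min_eq_right hk]
    obtain ⟨h, hh, hndvd⟩ := exists_eq_pow_rootMultiplicity_mul_and_not_dvd d hd.ne_zero t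
    set a := d.rootMultiplicity t
    rw [hh] at hd
    have hc : IsCoprime ((X - C t) ^ (k - a)) h :=
      IsCoprime.pow_left (((irreducible_X_sub_C t).coprime_iff_not_dvd).2 hndvd)
    have := kerDim_eq_natDegree (hm a) ((hm a).of_mul_monic_left hd) hc
    rwa [← pow_add, Nat.add_sub_cancel' hk, hn, ← hh] at this

theorem aeval_X_sub_C_pow (u : Module.End K E) (t : K) (k : ℕ) :
    aeval u ((X - C t) ^ k) = (u - algebraMap K (Module.End K E) t) ^ k := by
  rw [map_pow, map_sub, aeval_X, aeval_C]

/-- A factor with multiplicity `m` at `t` contributes `min k m - min (k - 1) m`, which is `1` if `k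
≤ m` and `0` otherwise. -/
theorem IsElementaryFactors.jordanNum_eq {u : Module.End K E} {L : List K[X]}
    (h : IsElementaryFactors u L) (t : K) {k : ℕ} (hk : 1 ≤ k) :
    jordanNum u t k = L.countP fun P => k ≤ P.rootMultiplicity t := by
  rw [jordanNum, ← aeval_X_sub_C_pow, ← aeval_X_sub_C_pow, h.finrank_ker, h.finrank_ker]
  have hL := h.1
  clear h
  suffices (L.map (kerDim ((X - C t) ^ k))).sum = (L.map (kerDim ((X - C t) ^ (k - 1)))).sum +
      L.countP fun P => k ≤ P.rootMultiplicity t by omega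
  induction L with
  | nil => simp
  | cons P L ih =>
    rw [List.map_cons, List.map_cons, List.sum_cons, List.sum_cons, List.countP_cons,
      ih fun Q hQ => hL Q (by simp [hQ]), kerDim_X_sub_C_pow _ _ (hL P (by simp)).1,
      kerDim_X_sub_C_pow _ _ (hL P (by simp)).1]
    by_cases hP : k ≤ P.rootMultiplicity t
    · simp only [hP, decide_true, if_true]; omega
    · simp only [hP, decide_false]; simp; omega

/-- As `f` and `g` increase along the list, the sets counted are final segments, so comparing their
sizes is comparing them by inclusion. The conclusion at `P` is the case `k = f P - 1`. -/
theorem le_add_one_of_countP_le {ι : Type*} (f g : ι → ℕ) : ∀ L : List ι,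
    L.Pairwise (fun P Q => f P ≤ f Q ∧ g P ≤ g Q) →
    (∀ k, 1 ≤ k → L.countP (fun P => k + 1 ≤ f P) ≤ L.countP fun P => k ≤ g P) →
    ∀ P ∈ L, f P ≤ g P + 1 := by
  intro L
  induction L with
  | nil => simp
  | cons P L ih =>
    intro hL h
    obtain ⟨h1, h2⟩ := List.pairwise_cons.1 hL
    have all_f : ∀ k, k ≤ f P → L.countP (fun Q => k ≤ f Q) = L.length := fun k hk =>
      List.countP_eq_length.2 fun Q hQ => by simpa using hk.trans (h1 Q hQ).1
    have all_g : ∀ k, k ≤ g P → L.countP (fun Q => k ≤ g Q) = L.length := fun k hk =>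
      List.countP_eq_length.2 fun Q hQ => by simpa using hk.trans (h1 Q hQ).2
    have h3 : ∀ k, 1 ≤ k → k + 1 ≤ f P → k ≤ g P := by
      intro k hk hf
      by_contra hg
      have := h k hk
      rw [List.countP_cons, List.countP_cons, all_f _ hf] at this
      simp only [hf, hg, decide_true, decide_false, if_true] at this
      have h4 := List.countP_le_length (p := fun Q => decide (k ≤ g Q)) (l := L)
      simp at this
      omega
    intro Q hQ
    rcases List.mem_cons.1 hQ with rfl | hQ
    · by_contra hlt
      have := h3 (f Q - 1) (by omega) (by omega)
      omega
    · refine ih h2 (fun k hk => ?_) Q hQ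
      by_cases hg : k ≤ g P
      · rw [all_g k hg]; exact List.countP_le_length
      · have hf : ¬ k + 1 ≤ f P := fun hf => hg (h3 k hk hf)
        have := h k hk
        rw [List.countP_cons, List.countP_cons] at this
        simpa [hf, hg] using this

theorem rootMultiplicity_comp_negX (P : K[X]) (t : K) :
    (P.comp (-X)).rootMultiplicity t = P.rootMultiplicity (-t) := by
  have := rootMultiplicity_comp_C_mul_X_add_C P (-1) 0 t isUnit_one.neg
  simpa using this

theorem rootMultiplicity_le_of_dvd {P Q : K[X]} (hQ : Q ≠ 0) (h : P ∣ Q) (t : K) :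
    P.rootMultiplicity t ≤ Q.rootMultiplicity t :=
  (le_rootMultiplicity_iff hQ).2 ((pow_rootMultiplicity_dvd P t).trans h)

/-- As `P` splits, it suffices to compare multiplicities: `X ↦ -X` exchanges those of `α` and `-α`,
and the extra factor adds one at `α`. -/
theorem dvd_X_sub_C_mul_comp_negX {P : K[X]} (hP : P.Monic) (hs : P.Splits) {α : K}
    (hr : ∀ t ∈ P.roots, t = 0 ∨ t = α ∨ t = -α)
    (h1 : P.rootMultiplicity α ≤ P.rootMultiplicity (-α) + 1)
    (h2 : P.rootMultiplicity (-α) ≤ P.rootMultiplicity α) :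
    P ∣ (X - C α) * P.comp (-X) := by
  classical
  have hne : P.comp (-X) ≠ 0 := fun h => hP.ne_zero (comp_neg_X_eq_zero_iff.1 h)
  have hne' : (X - C α) * P.comp (-X) ≠ 0 := mul_ne_zero (X_sub_C_ne_zero α) hne
  conv_lhs => rw [hs.eq_prod_roots_of_monic hP]
  rw [Multiset.prod_X_sub_C_dvd_iff_le_roots hne', Multiset.le_iff_count]
  intro t
  by_cases ht : t ∈ P.roots
  · rw [count_roots, count_roots, rootMultiplicity_mul hne', rootMultiplicity_comp_negX,
      rootMultiplicity_X_sub_C]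
    rcases hr t ht with rfl | rfl | rfl
    · simp
    · simp only [if_true]; omega
    · rw [neg_neg]; omega
  · rw [Multiset.count_eq_zero_of_notMem ht]; exact Nat.zero_le _

theorem finrank_ker_aeval_restrict {W : Submodule K E} {u : Module.End K E}
    (h : ∀ x ∈ W, u x ∈ W) (q : K[X]) (hq : LinearMap.ker (aeval u q) ≤ W) :
    Module.finrank K (LinearMap.ker (aeval (u.restrict h) q)) =
      Module.finrank K (LinearMap.ker (aeval u q)) := by
  have : LinearMap.ker (aeval (u.restrict h) q) = (LinearMap.ker (aeval u q)).comap W.subtype := by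
    ext x
    rw [LinearMap.mem_ker, Submodule.mem_comap, LinearMap.mem_ker, Submodule.subtype_apply,
      ← aeval_restrict_apply h, ZeroMemClass.coe_eq_zero]
  rw [this, (Submodule.comapSubtypeEquivOfLe hq).finrank_eq]

theorem mapsTo_ker_aeval (u : Module.End K E) (q : K[X]) :
    ∀ x ∈ LinearMap.ker (aeval u q), u x ∈ LinearMap.ker (aeval u q) := by
  intro x hx
  rw [LinearMap.mem_ker] at hx ⊢
  have h := congrArg (aeval u) (mul_comm q X)
  rw [map_mul, map_mul, aeval_X] at h
  have := LinearMap.congr_fun h x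
  rw [Module.End.mul_apply, Module.End.mul_apply, hx, map_zero] at this
  exact this

theorem roots_partOn (S : Set K) (p : K[X]) : ∀ t ∈ (partOn S p).roots, t ∈ S := by
  classical
  intro t ht
  rw [partOn, roots_multiset_prod_X_sub_C] at ht
  exact (Multiset.mem_filter.1 ht).2

theorem partOn_monic (S : Set K) (p : K[X]) : (partOn S p).Monic :=
  monic_multiset_prod_of_monic _ _ fun t _ => monic_X_sub_C t

theorem partOn_splits (S : Set K) (p : K[X]) : (partOn S p).Splits := by
  classical
  refine Splits.multisetProd fun f hf => ?_
  obtain ⟨t, -, rfl⟩ := Multiset.mem_map.1 hf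
  exact Splits.X_sub_C t

/-- Intertwined Jordan numbers provide the square root on the part of the space on which `u` has
its eigenvalues in `{0, α, -α}`. -/
theorem hasSkewRoot_on [FiniteDimensional K E] (α : K) (u : Module.End K E)
    (h : Intertwined (jordanNum u α) (jordanNum u (-α))) :
    HasSkewRoot α (u.restrict (mapsTo_ker_aeval u (partOn {0, α, -α} (minpoly K u)))) := by
  set S : Set K := {0, α, -α} with hS
  set W := LinearMap.ker (aeval u (partOn S (minpoly K u)))
  set w := u.restrict (mapsTo_ker_aeval u (partOn S (minpoly K u)))
  obtain ⟨L, hL⟩ := exists_isElementaryFactors w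
  have hμ : minpoly K u ≠ 0 := minpoly.ne_zero (Algebra.IsIntegral.isIntegral u)
  have hker : ∀ t ∈ S, ∀ k, LinearMap.ker (aeval u ((X - C t) ^ k)) ≤ W := by
    intro t ht k x hx
    -- The vector is killed by a power of `X - t`, which is prime to `partOff`, and by the whole
    -- minimal polynomial; so `partOn` kills it.
    refine aeval_eq_zero_of_isCoprime (f := (X - C t) ^ k) (B := partOff S (minpoly K u)) hx ?_ ?_
    · rw [partOn_mul_partOff, minpoly.aeval]; rfl
    · refine IsCoprime.pow_left (((irreducible_X_sub_C t).coprime_iff_not_dvd).2 ?_)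
      rw [dvd_iff_isRoot]
      exact not_isRoot_partOff S _ hμ t ht
  have hjn : ∀ t ∈ S, ∀ k, jordanNum w t k = jordanNum u t k := by
    intro t ht k
    rw [jordanNum, jordanNum, ← aeval_X_sub_C_pow, ← aeval_X_sub_C_pow, ← aeval_X_sub_C_pow,
      ← aeval_X_sub_C_pow, finrank_ker_aeval_restrict _ _ (hker t ht _),
      finrank_ker_aeval_restrict _ _ (hker t ht _)]
  have hαS : α ∈ S := by simp [hS]
  have hαS' : -α ∈ S := by simp [hS]
  have hcount : ∀ t ∈ S, ∀ k, 1 ≤ k →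
      jordanNum u t k = L.countP fun P => k ≤ P.rootMultiplicity t := fun t ht k hk => by
    rw [← hjn t ht, hL.jordanNum_eq t hk]
  have hmono : L.Pairwise fun P Q => ∀ t, P.rootMultiplicity t ≤ Q.rootMultiplicity t := by
    refine List.Pairwise.imp_of_mem ?_ hL.2.1
    intro P Q _ hQ hPQ t
    exact rootMultiplicity_le_of_dvd (hL.1 Q hQ).1.ne_zero hPQ t
  have hab : ∀ P ∈ L, P.rootMultiplicity α ≤ P.rootMultiplicity (-α) + 1 :=
    le_add_one_of_countP_le _ _ L (hmono.imp fun hPQ => ⟨hPQ _, hPQ _⟩) fun k hk => by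
      rw [← hcount _ hαS _ (by omega), ← hcount _ hαS' _ hk]
      exact (h k hk).2
  have hba : ∀ P ∈ L, P.rootMultiplicity (-α) ≤ P.rootMultiplicity α + 1 :=
    le_add_one_of_countP_le _ _ L (hmono.imp fun hPQ => ⟨hPQ _, hPQ _⟩) fun k hk => by
      rw [← hcount _ hαS' _ (by omega), ← hcount _ hαS _ hk]
      exact (h k hk).1
  obtain ⟨hL1, -, e, he⟩ := hL
  refine hasSkewRoot_of_cyclic_decomposition e he (fun i => (hL1 _ (L.get_mem i)).1) α fun i => ?_
  have hmem := L.get_mem i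
  set P := L.get i
  have hP : P.Monic := (hL1 _ hmem).1
  have hdvd : P ∣ partOn S (minpoly K u) := dvd_of_aeval_eq_zero e he (by
    ext x
    rw [aeval_restrict_apply]
    exact x.2) i
  have hsplit : P.Splits := (partOn_splits S _).of_dvd (partOn_monic S _).ne_zero hdvd
  have hroots : ∀ t ∈ P.roots, t ∈ S := fun t ht =>
    roots_partOn S _ t (Multiset.mem_of_le (roots.le_of_dvd (partOn_monic S _).ne_zero hdvd) ht)
  -- The root with the larger multiplicity is the one that needs the additional linear factor; the
  -- sign is chosen so that `c(X) c(-X) = α² - X²`.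
  rcases le_or_gt (P.rootMultiplicity (-α)) (P.rootMultiplicity α) with hle | hlt
  · refine ⟨-(X - C α), ?_, ?_⟩
    · simp only [neg_comp, sub_comp, X_comp, C_comp, C_pow]; ring
    · rw [neg_mul, dvd_neg]
      exact dvd_X_sub_C_mul_comp_negX hP hsplit (fun t ht => hroots t ht) (hab P hmem) hle
  · refine ⟨X - C (-α), ?_, ?_⟩
    · simp only [sub_comp, neg_comp, X_comp, C_comp, C_pow, C_neg]; ring
    · refine dvd_X_sub_C_mul_comp_negX (α := -α) hP hsplit ?_ ?_ ?_
      · intro t ht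
        have h3 : t = 0 ∨ t = α ∨ t = -α := hroots t ht
        rw [neg_neg]
        exact h3.imp id Or.symm
      · rw [neg_neg]; exact hba P hmem
      · rw [neg_neg]; exact hlt.le

theorem hasSkewRoot_of_isEvenPoly {u : Module.End K E} {L : List K[X]}
    (hL : IsElementaryFactors u L) (h : ∀ P ∈ L, IsEvenPoly P) (α : K) : HasSkewRoot α u := by
  obtain ⟨hL1, -, e, he⟩ := hL
  refine hasSkewRoot_of_cyclic_decomposition e he (fun i => (hL1 _ (L.get_mem i)).1) α
    fun i => ⟨C α - X, ?_, ?_⟩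
  · simp only [sub_comp, X_comp, C_comp, C_pow]; ring
  · obtain ⟨Q, hQ⟩ := h _ (L.get_mem i)
    have : (L.get i).comp (-X) = L.get i := by
      rw [hQ, comp_assoc]; simp
    rw [this]
    exact dvd_mul_left _ _

end Counting

/-! ### From the square root to the two conditions -/

section Necessity

variable {K E : Type*} [Field K] [AddCommGroup E] [Module K E]

theorem finrank_map_add_finrank_inf_ker [FiniteDimensional K E] (v : Module.End K E)
    (X : Submodule K E) :
    Module.finrank K (X.map v) + Module.finrank K (LinearMap.ker v ⊓ X : Submodule K E) =
      Module.finrank K X := by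
  have h := LinearMap.finrank_range_add_finrank_ker (v.domRestrict X)
  rw [LinearMap.range_domRestrict, LinearMap.ker_domRestrict] at h
  rw [← h]
  congr 1
  have := (Submodule.comapSubtypeEquivOfLe (p := LinearMap.ker v ⊓ X) (q := X) inf_le_right).finrank_eq
  rw [← this, Submodule.comap_inf, Submodule.comap_subtype_self, inf_top_eq]

/-- The growth of the kernels of the powers of `v` in `G` is bounded by the growth, one step
earlier, in a subspace that contains `v G`. -/
theorem finrank_ker_pow_inf_le [FiniteDimensional K E] (v : Module.End K E)
    {G G' : Submodule K E} (hG : ∀ x ∈ G, v x ∈ G') (j : ℕ) :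
    Module.finrank K (LinearMap.ker (v ^ (j + 2)) ⊓ G : Submodule K E) +
        Module.finrank K (LinearMap.ker (v ^ j) ⊓ G' : Submodule K E) ≤
      Module.finrank K (LinearMap.ker (v ^ (j + 1)) ⊓ G' : Submodule K E) +
        Module.finrank K (LinearMap.ker (v ^ (j + 1)) ⊓ G : Submodule K E) := by
  set A := LinearMap.ker (v ^ (j + 2)) ⊓ G
  set B := LinearMap.ker (v ^ (j + 1)) ⊓ G
  set A' := LinearMap.ker (v ^ (j + 1)) ⊓ G'
  set B' := LinearMap.ker (v ^ j) ⊓ G'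
  have hpow : ∀ (n : ℕ) x, (v ^ (n + 1)) x = (v ^ n) (v x) := fun n x => by
    rw [pow_succ, Module.End.mul_apply]
  have h1 : A.map v ⊔ B' ≤ A' := by
    refine sup_le ?_ ?_
    · rintro _ ⟨x, ⟨hx, hx'⟩, rfl⟩
      refine ⟨?_, hG x hx'⟩
      rw [SetLike.mem_coe, LinearMap.mem_ker, ← hpow]; exact hx
    · rintro x ⟨hx, hx'⟩
      refine ⟨?_, hx'⟩
      have hx0 : (v ^ j) x = 0 := hx
      rw [SetLike.mem_coe, LinearMap.mem_ker, pow_succ', Module.End.mul_apply, hx0, map_zero]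
  have h2 : A.map v ⊓ B' ≤ B.map v := by
    rintro _ ⟨⟨x, ⟨hx, hx'⟩, rfl⟩, hy, -⟩
    refine ⟨x, ⟨?_, hx'⟩, rfl⟩
    rw [SetLike.mem_coe, LinearMap.mem_ker, hpow]; exact hy
  have h3 : LinearMap.ker v ⊓ A ≤ LinearMap.ker v ⊓ B := by
    rintro x ⟨hx, -, hx'⟩
    refine ⟨hx, ?_, hx'⟩
    rw [SetLike.mem_coe, LinearMap.mem_ker, hpow, show v x = 0 from hx, map_zero]
  have e1 := finrank_map_add_finrank_inf_ker v A
  have e2 := finrank_map_add_finrank_inf_ker v B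
  have e3 := Submodule.finrank_sup_add_finrank_inf_eq (A.map v) B'
  have l1 := Submodule.finrank_mono h1
  have l2 := Submodule.finrank_mono h2
  have l3 := Submodule.finrank_mono h3
  omega

/-- Moving `v` across `u` changes the sign, so `f(-u) v = v f(u)`; this is how `v` transports
kernels of polynomials in `u`. -/
theorem aeval_comp_negX_mul {u v : Module.End K E} (h : u * v = -(v * u)) (f : K[X]) :
    aeval u (f.comp (-X)) * v = v * aeval u f := by
  induction f using Polynomial.induction_on with
  | C a => rw [C_comp, aeval_C, Algebra.commutes]
  | add p q hp hq => rw [add_comp, map_add, map_add, add_mul, mul_add, hp, hq]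
  | monomial n a ih =>
    rw [pow_succ, ← mul_assoc, mul_comp, X_comp, map_mul, map_neg, aeval_X, mul_assoc, neg_mul, h,
      neg_neg, ← mul_assoc, ih, map_mul _ (C a * X ^ n), aeval_X, mul_assoc]

theorem isCoprime_X_sub_C_pow {s t : K} (h : s ≠ t) (m n : ℕ) :
    IsCoprime ((X - C s) ^ m) ((X - C t) ^ n) :=
  (isCoprime_X_sub_C_of_isUnit_sub (sub_ne_zero.2 h).isUnit).pow

theorem intertwined_of_hasSkewRoot [FiniteDimensional K E] (hK : (2 : K) ≠ 0) {α : K}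
    (hα : α ≠ 0) {u : Module.End K E} (h : HasSkewRoot α u) :
    Intertwined (jordanNum u α) (jordanNum u (-α)) := by
  obtain ⟨v, h1, h2⟩ := h
  set N := Module.finrank K E
  -- The exponent `dim E` makes `G t` the whole generalized eigenspace.
  let G : K → Submodule K E := fun t => LinearMap.ker (aeval u ((X - C t) ^ N))
  have hne : α ≠ -α := by
    intro h
    have : 2 * α = 0 := by linear_combination h
    exact (mul_eq_zero.1 this).elim hK hα
  have hG : ∀ t, ∀ x ∈ G t, v x ∈ G (-t) := by
    intro t x hx
    have hx' : aeval u ((X - C t) ^ N) x = 0 := hx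
    have e : (X - C (-t)) ^ N = C ((-1) ^ N) * ((X - C t) ^ N).comp (-X) := by
      rw [pow_comp, C_pow, ← mul_pow]
      simp only [sub_comp, X_comp, C_comp, C_neg, C_1]
      ring
    change aeval u ((X - C (-t)) ^ N) (v x) = 0
    rw [e, map_mul, Module.End.mul_apply, ← Module.End.mul_apply _ v, aeval_comp_negX_mul h1,
      Module.End.mul_apply v, hx', map_zero, map_zero]
  have hv2 : v ^ 2 = aeval u (-((X - C α) * (X - C (-α)))) := by
    have : -((X - C α) * (X - C (-α))) = C (α ^ 2) - X * X := by
      rw [C_neg, C_pow]; ring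
    rw [this, sq, h2, map_sub, aeval_C, map_mul, aeval_X]
  -- Up to sign, `v^(2k)` is `(u - t)^k (u + t)^k`, and `(u + t)^k` is injective on `G t`.
  have hGv : ∀ t, t ≠ -t → (t = α ∨ t = -α) → ∀ k, LinearMap.ker (v ^ (2 * k)) ⊓ G t =
      LinearMap.ker ((u - algebraMap K (Module.End K E) t) ^ k) := by
    intro t ht htα k
    have e : v ^ (2 * k) = aeval u (C ((-1) ^ k) * ((X - C t) ^ k * (X - C (-t)) ^ k)) := by
      rw [pow_mul, hv2, ← map_pow, neg_pow, C_pow, show C (-1 : K) = -1 by simp]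
      rcases htα with rfl | rfl
      · rw [mul_pow]
      · rw [neg_neg, mul_comm (X - C α), mul_pow]
    have hunit : ∀ x : E, aeval u (C ((-1 : K) ^ k)) x = 0 → x = 0 := by
      intro x hx
      rw [aeval_C, Module.algebraMap_end_apply] at hx
      exact (smul_eq_zero.1 hx).resolve_left (pow_ne_zero _ (neg_ne_zero.2 one_ne_zero))
    rw [← aeval_X_sub_C_pow]
    ext x
    rw [Submodule.mem_inf, e, LinearMap.mem_ker, LinearMap.mem_ker]
    constructor
    · rintro ⟨hx, hx'⟩
      rw [map_mul, Module.End.mul_apply] at hx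
      exact aeval_eq_zero_of_isCoprime hx' (hunit _ hx) (isCoprime_X_sub_C_pow ht _ _)
    · intro hx
      refine ⟨?_, ?_⟩
      · rw [mul_comm ((X - C t) ^ k), ← mul_assoc, map_mul, Module.End.mul_apply, hx, map_zero]
      · have := Module.End.ker_pow_le_ker_pow_finrank (u - algebraMap K (Module.End K E) t) k
        rw [← aeval_X_sub_C_pow, ← aeval_X_sub_C_pow] at this
        exact this hx
  let D : K → ℕ → ℕ := fun t j =>
    Module.finrank K (LinearMap.ker (v ^ j) ⊓ G t : Submodule K E)
  have hD : ∀ t j, D t (j + 2) + D (-t) j ≤ D (-t) (j + 1) + D t (j + 1) := fun t j =>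
    finrank_ker_pow_inf_le v (hG t) j
  have hj : ∀ t, t ≠ -t → (t = α ∨ t = -α) → ∀ k,
      jordanNum u t k = D t (2 * k) - D t (2 * (k - 1)) := by
    intro t ht htα k
    rw [jordanNum, ← hGv t ht htα, ← hGv t ht htα]
  have key : ∀ t, t ≠ -t → (t = α ∨ t = -α) → ∀ k, 1 ≤ k →
      jordanNum u t (k + 1) ≤ jordanNum u (-t) k := by
    intro t ht htα k hk
    obtain ⟨m, rfl⟩ := Nat.exists_eq_add_of_le' hk
    rw [hj t ht htα, hj (-t) (by rwa [neg_neg, ne_comm])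
      (htα.elim (fun h => Or.inr (by rw [h])) fun h => Or.inl (by rw [h, neg_neg]))]
    -- With `d t j = D t j - D t (j - 1)`, `hD` reads `d t (j + 2) ≤ d (-t) (j + 1)`. The increment
    -- `d t (2m + 4)` is lowered three times (`a1`, `a2`, `a3`) to reach `d (-t) (2m + 1)`, while `d
    -- t (2m + 3)` is lowered once (`a4`) to `d (-t) (2m + 2)`.
    have a1 := hD t (2 * m + 2)
    have a2 := hD (-t) (2 * m + 1)
    have a3 := hD t (2 * m)
    have a4 := hD t (2 * m + 1)
    rw [neg_neg] at a2
    rw [show 2 * (m + 1 + 1) = 2 * m + 4 by ring, show 2 * (m + 1 + 1 - 1) = 2 * m + 2 by omega,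
      show 2 * (m + 1) = 2 * m + 2 by ring, show 2 * (m + 1 - 1) = 2 * m by omega]
    simp only [Nat.add_assoc, Nat.reduceAdd] at a1 a2 a3 a4
    omega
  intro k hk
  refine ⟨?_, key α hne (Or.inl rfl) k hk⟩
  have := key (-α) (by rw [neg_neg]; exact hne.symm) (Or.inr rfl) k hk
  rwa [neg_neg] at this

theorem exists_even_factors_of_hasSkewRoot [FiniteDimensional K E] (hK : (2 : K) ≠ 0) {α : K}
    {u : Module.End K E} (h : HasSkewRoot α u) :
    ∃ L, IsElementaryFactors (endOff {0, α, -α} u) L ∧ ∀ P ∈ L, IsEvenPoly P := by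
  obtain ⟨v, h1, h2⟩ := h
  set S : Set K := {0, α, -α} with hS
  have hμ : minpoly K u ≠ 0 := minpoly.ne_zero (Algebra.IsIntegral.isIntegral u)
  set Q := partOff S (minpoly K u)
  have hroot : ∀ t ∈ S, ¬ Q.IsRoot t := not_isRoot_partOff S _ hμ
  have hcop : ∀ t ∈ S, IsCoprime Q (X - C t) := fun t ht =>
    (((irreducible_X_sub_C t).coprime_iff_not_dvd).2 (by
      rw [dvd_iff_isRoot]; exact hroot t ht)).symm
  have hneg : ∀ t ∈ S, -t ∈ S := by
    rintro t (rfl | rfl | rfl)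
    · simp [hS]
    · simp [hS]
    · simp [hS]
  have hmap : ∀ x ∈ spaceOff S u, v x ∈ spaceOff S u := by
    intro x hx
    have hx' : aeval u Q x = 0 := hx
    -- `v x` is killed by `Q(-X)`, which is prime to `partOn` because `{0, α, -α}` is symmetric, and
    -- by the minimal polynomial; hence by `Q`.
    refine aeval_eq_zero_of_isCoprime (f := Q.comp (-X)) (B := partOn S (minpoly K u)) ?_ ?_ ?_
    · rw [← Module.End.mul_apply, aeval_comp_negX_mul h1, Module.End.mul_apply, hx', map_zero]
    · rw [mul_comm, partOn_mul_partOff, minpoly.aeval]; rfl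
    · refine (isCoprime_partOn _ fun t ht hr => hroot (-t) (hneg t ht) ?_).symm
      simpa [IsRoot.def, eval_comp] using hr
  have inj : ∀ B : K[X], IsCoprime Q B → ∀ x : spaceOff S u, aeval u B x = 0 → x = 0 := by
    intro B hB x hx
    have : aeval u (1 : K[X]) (x : E) = 0 :=
      aeval_eq_zero_of_isCoprime (f := Q) x.2 (by rwa [one_mul]) hB
    rw [map_one, Module.End.one_apply] at this
    exact Subtype.ext this
  have hu : Function.Injective (endOff S u) := by
    rw [← LinearMap.ker_eq_bot, LinearMap.ker_eq_bot']
    intro x hx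
    refine inj (X - C 0) (hcop 0 (by simp [hS])) x ?_
    rw [C_0, sub_zero, aeval_X]
    exact congrArg Subtype.val hx
  have hv : Function.Injective (v.restrict hmap) := by
    rw [← LinearMap.ker_eq_bot, LinearMap.ker_eq_bot']
    intro x hx
    have hx' : v x = 0 := congrArg Subtype.val hx
    refine inj ((X - C α) * (X - C (-α)))
      ((hcop α (by simp [hS])).mul_right (hcop (-α) (by simp [hS]))) x ?_
    have : (X - C α) * (X - C (-α)) = -(C (α ^ 2) - X * X) := by
      rw [C_neg, C_pow]; ring
    rw [this, map_neg, map_sub, aeval_C, map_mul, aeval_X, ← h2, LinearMap.neg_apply,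
      Module.End.mul_apply, hx', map_zero, neg_zero]
  obtain ⟨L, hL⟩ := exists_isElementaryFactors (endOff S u)
  -- The restriction of `v` is the automorphism conjugating the induced endomorphism to its
  -- opposite.
  refine ⟨L, hL, hL.isEvenPoly hK hu (LinearEquiv.ofInjectiveEndo _ hv) fun x => ?_⟩
  apply Subtype.ext
  have := LinearMap.congr_fun h1 (x : E)
  exact neg_eq_iff_eq_neg.1 this.symm

end Necessity

end Composite

theorem theorem2 {K E : Type*} [Field K] [AddCommGroup E] [Module K E] [FiniteDimensional K E]
    (hK : ringChar K ≠ 2) (α : K) (hα : α ≠ 0) (u : Module.End K E) :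
    Composite.IsComposite α (-α) u ↔
      (Composite.Intertwined (Composite.jordanNum u α) (Composite.jordanNum u (-α)) ∧
        ∃ L : List (Polynomial K),
          Composite.IsElementaryFactors (Composite.endOff {0, α, -α} u) L ∧
            ∀ P ∈ L, Composite.IsEvenPoly P) := by
  have h2 : (2 : K) ≠ 0 := Ring.two_ne_zero hK
  rw [Composite.isComposite_iff_hasSkewRoot h2 hα]
  constructor
  · intro h
    exact ⟨Composite.intertwined_of_hasSkewRoot h2 hα h,
      Composite.exists_even_factors_of_hasSkewRoot h2 h⟩
  · rintro ⟨h, L, hL, hL'⟩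
    exact Composite.HasSkewRoot.of_isCompl (Composite.isCompl_spaceOff {0, α, -α} u) _ _
      (Composite.hasSkewRoot_on α u h) (Composite.hasSkewRoot_of_isEvenPoly hL hL' α)
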